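/- Let $G$ be a Hausdorff locally compact topological group that is compactly generated, i.e. generated as a group by some compact subset. Suppose that every discrete quotient of $G$ is finite: whenever $N$ is a normal subgroup of $G$ such that $G/N$, with the quotient topology, is discrete, then $G/N$ is finite. Let $\mathrm{Res}(G)$ be the discrete residual of $G$, that is, the intersection of all open normal subgroups of $G$. Then $\mathrm{Res}(G)$ is closed in $G$; it is cocompact, i.e. $G/\mathrm{Res}(G)$ is compact; it is characteristic, i.e. $\varphi(\mathrm{Res}(G))=\mathrm{Res}(G)$ for every automorphism $\varphi$ of the topological group $G$ (a group automorphism that is also a homeomorphism); and it has no non-trivial discrete quotient, i.e. whenever $N$ is a normal subgroup of $\mathrm{Res}(G)$, equipped with the subspace topology, such that $\mathrm{Res}(G)/N$ is discrete, then $N=\mathrm{Res}(G)$. -/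

import Mathlib

/-- A topological group is compactly generated if some compact subset generates it as an
abstract group. -/
def IsCompactlyGeneratedGroup (G : Type*) [Group G] [TopologicalSpace G] : Prop :=
  ∃ K : Set G, IsCompact K ∧ Subgroup.closure K = ⊤

/-- The discrete residual of a topological group: the intersection of all its open normal
subgroups. -/
def discreteResidual (G : Type*) [Group G] [TopologicalSpace G] : Subgroup G :=
  ⨅ U : OpenNormalSubgroup G, U.toSubgroup

/-- Invariance of a subgroup under every topological group automorphism. -/
def IsTopologicallyCharacteristic {G : Type*} [Group G] [TopologicalSpace G]
    (H : Subgroup G) : Prop :=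
  ∀ φ : G ≃ₜ* G, H.map (φ : G →* G) = H

/-!
Write `R` for the discrete residual of `G`. It is closed and characteristic because it is the
intersection of the family of open normal subgroups, whose members are closed and which
automorphisms permute. Since this family is directed, compactness gives the main tool
`exists_openNormalSubgroup_inter_subset`: if an open set `O` contains `R` and `K` is compact, then
`K ∩ M ⊆ O` for some open normal subgroup `M`.

*Cocompactness.* Let `L` be a compact symmetric generating neighbourhood of `1`, and choose `M` with
`L * L * L ∩ M ⊆ interior L * R`. Then `W = M ∩ interior L * R` is a subgroup, because products of
two elements stay in `L * L * R`, and it is normalised by `L`, because conjugates stay in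
`L * L * L * R`. So `W` is an open normal subgroup; it has finite index and lies in `L * R`, hence
`G = K * R` with `K` compact.

*No discrete quotients.* Cocompactness makes `R` compactly generated, by the Schreier argument. Let
`N` be an open normal subgroup of `R`.
* The intersection `V` of all `G`-conjugates of `N` is already an intersection over the compact set
  `K`, so it is still open in `R`.
* Modulo `V` the group `R` is discrete and finitely generated, so the elements of `G` centralising
  `R` modulo `V` form an open subgroup `C`.
* As `V` is open in `R`, a small neighbourhood `O` of `1` satisfies `O⁻¹ * O * O⁻¹ ∩ R ⊆ V`.
  For an open normal subgroup `M ⊆ O * R` the set `W = M ∩ O * V` is then an open subgroup of `G`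
  with `W ∩ R = V`.
* `W ∩ C` contains `V` and is centralised by `R` modulo `V`, so it is normalised by `R`; by the same
  compactness argument its normal core is open in `G`, and hence contains `R`.

Therefore `R ≤ W ∩ R = V ≤ N`.
-/

open Topology Pointwise Filter

/-! ### The discrete residual and its open normal overgroups -/

section Residual

variable {G : Type*} [Group G] [TopologicalSpace G]

theorem mem_discreteResidual_iff {x : G} :
    x ∈ discreteResidual G ↔ ∀ U : OpenNormalSubgroup G, x ∈ U.toSubgroup := by
  simp [discreteResidual, Subgroup.mem_iInf]

theorem discreteResidual_le {M : Subgroup G} (hM : M.Normal) (ho : IsOpen (M : Set G)) :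
    discreteResidual G ≤ M := fun _ hx =>
  mem_discreteResidual_iff.1 hx { toSubgroup := M, isOpen' := ho, isNormal' := hM }

instance discreteResidual_normal : (discreteResidual G).Normal :=
  Subgroup.normal_iInf_normal fun U => U.isNormal'

theorem isClosed_discreteResidual [IsTopologicalGroup G] :
    IsClosed (discreteResidual G : Set G) := by
  rw [discreteResidual, Subgroup.coe_iInf]
  exact isClosed_iInter fun U => U.toOpenSubgroup.isClosed

theorem map_discreteResidual_le (φ : G ≃ₜ* G) :
    (discreteResidual G).map (φ : G →* G) ≤ discreteResidual G := by
  rintro _ ⟨x, hx, rfl⟩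
  refine mem_discreteResidual_iff.2 fun U => ?_
  exact discreteResidual_le (U.isNormal'.comap (φ : G →* G))
    (U.isOpen'.preimage φ.continuous_toFun) hx

theorem isTopologicallyCharacteristic_discreteResidual :
    IsTopologicallyCharacteristic (discreteResidual G) := fun φ =>
  le_antisymm (map_discreteResidual_le φ) fun x hx =>
    ⟨φ.symm x, map_discreteResidual_le φ.symm ⟨x, hx, rfl⟩, φ.apply_symm_apply x⟩

/-- Inside a compact set, a single open normal subgroup already lies in a given open neighbourhood of
the discrete residual: the open normal subgroups form a directed family of closed sets. -/
theorem exists_openNormalSubgroup_inter_subset [IsTopologicalGroup G] {K O : Set G}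
    (hK : IsCompact K) (hO : IsOpen O) (hRO : (discreteResidual G : Set G) ⊆ O) :
    ∃ M : OpenNormalSubgroup G, ∀ x ∈ K, x ∈ M.toSubgroup → x ∈ O := by
  have : Nonempty (OpenNormalSubgroup G) :=
    ⟨{ toSubgroup := ⊤, isOpen' := isOpen_univ, isNormal' := inferInstance }⟩
  obtain ⟨M, hM⟩ := (hK.diff hO).elim_directed_family_closed
    (fun M : OpenNormalSubgroup G => (M.toSubgroup : Set G))
    (fun M => M.toOpenSubgroup.isClosed)
    (by
      refine Set.eq_empty_iff_forall_notMem.2 fun x hx => hx.1.2 (hRO ?_)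
      exact mem_discreteResidual_iff.2 fun U => Set.mem_iInter.1 hx.2 U)
    (fun M N => ⟨M ⊓ N, fun _ hx => hx.1, fun _ hx => hx.2⟩)
  refine ⟨M, fun x hxK hxM => by_contra fun hxO => ?_⟩
  exact Set.notMem_empty x (hM ▸ ⟨⟨hxK, hxO⟩, hxM⟩)

end Residual

/-! ### Conjugates and centralisers modulo an open subgroup -/

section Conjugation

variable {G : Type*} [Group G] [TopologicalSpace G] [IsTopologicalGroup G]

/-- If `G = K * R` with `K` compact and `R` normalises `A`, then the normal core of `A` is the
intersection of the conjugates of `A` by `K`, so it is open relative to a normal subgroup `X`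
whenever `A` is. -/
theorem eventually_mem_normalCore {R X A : Subgroup G} [hX : X.Normal] {K : Set G}
    (hK : IsCompact K) (hKR : ∀ g : G, ∃ k ∈ K, k⁻¹ * g ∈ R)
    (hA : ∀ r ∈ R, ∀ a ∈ A, r * a * r⁻¹ ∈ A) (hXA : ∀ᶠ x in 𝓝 (1 : G), x ∈ X → x ∈ A) :
    ∀ᶠ x in 𝓝 (1 : G), x ∈ X → x ∈ A.normalCore := by
  have h : ∀ᶠ x in 𝓝 (1 : G), ∀ k ∈ K, (k⁻¹ * x * k ∈ X → k⁻¹ * x * k ∈ A) := by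
    refine hK.eventually_forall_of_forall_eventually fun k _ => ?_
    have hc : Continuous fun p : G × G => p.2⁻¹ * p.1 * p.2 := by fun_prop
    have ht := hc.tendsto (1, k)
    simp only [mul_one, inv_mul_cancel] at ht
    exact ht.eventually hXA
  filter_upwards [h] with x hx hxX g
  obtain ⟨k, hk, hr⟩ := hKR g⁻¹
  have h1 := hx k hk (by simpa using hX.conj_mem x hxX k⁻¹)
  have h2 := hA _ (R.inv_mem hr) _ h1
  simpa [mul_assoc] using h2

/-- If `R` is a normal subgroup generated by a compact set and `V` is open relative to `R`, then the
elements centralising `R` modulo `V` form an open subgroup. -/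
theorem isOpen_comap_centralizer {R V : Subgroup G} [hR : R.Normal] [hV : V.Normal] {E : Set G}
    (hE : IsCompact E) (hER : Subgroup.closure E = R)
    (hRV : ∀ᶠ x in 𝓝 (1 : G), x ∈ R → x ∈ V) :
    IsOpen (((Subgroup.centralizer (R.map (QuotientGroup.mk' V) : Set (G ⧸ V))).comap
      (QuotientGroup.mk' V) : Subgroup G) : Set G) := by
  refine Subgroup.isOpen_of_mem_nhds _ (g := 1) ?_
  have h : ∀ᶠ g in 𝓝 (1 : G), ∀ s ∈ E, (s⁻¹ * (g * s * g⁻¹) ∈ R → s⁻¹ * (g * s * g⁻¹) ∈ V) := by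
    refine hE.eventually_forall_of_forall_eventually fun s _ => ?_
    have hc : Continuous fun p : G × G => p.2⁻¹ * (p.1 * p.2 * p.1⁻¹) := by fun_prop
    have ht := hc.tendsto (1, s)
    simp only [one_mul, inv_one, mul_one, inv_mul_cancel] at ht
    exact ht.eventually hRV
  filter_upwards [h] with g hg
  -- Commuting with `R` modulo `V` need only be checked on the generating set `E`.
  have hle : R ≤ (Subgroup.centralizer {QuotientGroup.mk' V g}).comap (QuotientGroup.mk' V) := by
    rw [← hER, Subgroup.closure_le]
    intro s hs
    have hsR : s ∈ R := hER ▸ Subgroup.subset_closure hs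
    have h1 := hg s hs (R.mul_mem (R.inv_mem hsR) (hR.conj_mem s hsR g))
    have h2 : (QuotientGroup.mk' V s) = QuotientGroup.mk' V (g * s * g⁻¹) :=
      QuotientGroup.eq.2 h1
    simp only [SetLike.mem_coe, Subgroup.mem_comap, Subgroup.mem_centralizer_singleton_iff]
    rw [map_mul, map_mul, map_inv, eq_mul_inv_iff_mul_eq] at h2
    exact h2
  simp only [SetLike.mem_coe, Subgroup.mem_comap, Subgroup.mem_centralizer_iff]
  rintro _ ⟨r, hr, rfl⟩
  exact Subgroup.mem_centralizer_singleton_iff.1 (hle hr)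

end Conjugation

/-! ### Cocompactness and compact generation of the discrete residual -/

section Cocompact

variable {G : Type*} [Group G] [TopologicalSpace G] [IsTopologicalGroup G]

theorem IsCompactlyGeneratedGroup.exists_symmetric_nhds [LocallyCompactSpace G]
    (hG : IsCompactlyGeneratedGroup G) :
    ∃ L : Set G, IsCompact L ∧ L ∈ 𝓝 (1 : G) ∧ (∀ x ∈ L, x⁻¹ ∈ L) ∧ Subgroup.closure L = ⊤ := by
  obtain ⟨S, hS, hgen⟩ := hG
  obtain ⟨L, hL, hL1⟩ := exists_compact_mem_nhds (1 : G)
  refine ⟨(S ∪ L) ∪ (S ∪ L)⁻¹, (hS.union hL).union (hS.union hL).inv,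
    mem_of_superset hL1 fun x hx => Or.inl (Or.inr hx), ?_, ?_⟩
  · rintro x (hx | hx)
    · exact Or.inr (by simpa using hx)
    · exact Or.inl hx
  · exact top_le_iff.1 (hgen ▸ Subgroup.closure_mono fun x hx => Or.inl (Or.inl hx))

/-- Some open normal subgroup is contained in `L * R`, where `R` is the discrete residual and `L` is
a compact symmetric generating neighbourhood of `1`. -/
theorem exists_openNormalSubgroup_subset_mul_discreteResidual {L : Set G} (hL : IsCompact L)
    (hL1 : L ∈ 𝓝 (1 : G)) (hinv : ∀ x ∈ L, x⁻¹ ∈ L) (hgen : Subgroup.closure L = ⊤) :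
    ∃ W : Subgroup G, W.Normal ∧ IsOpen (W : Set G) ∧
      (W : Set G) ⊆ L * (discreteResidual G : Set G) := by
  set R := discreteResidual G with hRdef
  have h1L : (1 : G) ∈ interior L := mem_interior_iff_mem_nhds.2 hL1
  have h1L' : (1 : G) ∈ L := interior_subset h1L
  have hO : IsOpen (interior L * (R : Set G)) := isOpen_interior.mul_right
  obtain ⟨M, hM⟩ := exists_openNormalSubgroup_inter_subset ((hL.mul hL).mul hL) hO
    (fun r hr => ⟨1, h1L, r, hr, one_mul r⟩)
  have hMn : M.toSubgroup.Normal := M.isNormal'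
  have hRM : R ≤ M.toSubgroup := discreteResidual_le hMn M.isOpen'
  -- Modulo `R`, an element of `M ∩ L * L * L` is already in `interior L`.
  have key : ∀ y ∈ L * L * L, ∀ r ∈ R, y * r ∈ M.toSubgroup →
      y * r ∈ interior L * (R : Set G) := by
    intro y hy r hr h
    obtain ⟨o, ho, r', hr', e⟩ := hM y hy ((M.toSubgroup.mul_mem_cancel_right (hRM hr)).1 h)
    exact ⟨o, ho, r' * r, R.mul_mem hr' hr, by rw [← e]; simp [mul_assoc]⟩
  let W : Subgroup G :=
    { carrier := {x | x ∈ M.toSubgroup ∧ x ∈ interior L * (R : Set G)}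
      one_mem' := ⟨M.toSubgroup.one_mem, 1, h1L, 1, R.one_mem, one_mul 1⟩
      mul_mem' := by
        rintro _ _ ⟨hx, a, ha, r, hr, rfl⟩ ⟨hy, b, hb, t, ht, rfl⟩
        have hxy := M.toSubgroup.mul_mem hx hy
        refine ⟨hxy, ?_⟩
        have e : a * r * (b * t) = a * b * 1 * (b⁻¹ * r * b * t) := by group
        simp only [e] at hxy ⊢
        refine key _ (Set.mul_mem_mul (Set.mul_mem_mul (interior_subset ha) (interior_subset hb))
          h1L') _ (R.mul_mem ?_ ht) hxy
        simpa using discreteResidual_normal.conj_mem r hr b⁻¹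
      inv_mem' := by
        rintro _ ⟨hx, a, ha, r, hr, rfl⟩
        have hxi := M.toSubgroup.inv_mem hx
        refine ⟨hxi, ?_⟩
        have e : (a * r)⁻¹ = a⁻¹ * 1 * 1 * (a * r⁻¹ * a⁻¹) := by group
        simp only [e] at hxi ⊢
        exact key _ (Set.mul_mem_mul (Set.mul_mem_mul (hinv _ (interior_subset ha)) h1L') h1L') _
          (discreteResidual_normal.conj_mem _ (R.inv_mem hr) a) hxi }
  have hconj : ∀ s ∈ L, ∀ x ∈ W, s * x * s⁻¹ ∈ W := by
    rintro s hs _ ⟨hx, a, ha, r, hr, rfl⟩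
    have hsx := hMn.conj_mem _ hx s
    refine ⟨hsx, ?_⟩
    have e : s * (a * r) * s⁻¹ = s * a * s⁻¹ * (s * r * s⁻¹) := by group
    simp only [e] at hsx ⊢
    exact key _ (Set.mul_mem_mul (Set.mul_mem_mul hs (interior_subset ha)) (hinv s hs)) _
      (discreteResidual_normal.conj_mem r hr s) hsx
  refine ⟨W, ?_, M.isOpen'.inter hO, fun x hx => Set.mul_subset_mul_right interior_subset hx.2⟩
  rw [← Subgroup.normalizer_eq_top_iff, ← top_le_iff, ← hgen, Subgroup.closure_le]
  intro s hs
  refine Subgroup.mem_normalizer_iff.2 fun x => ⟨hconj s hs x, fun h => ?_⟩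
  simpa [mul_assoc] using hconj _ (hinv s hs) _ h

theorem exists_isCompact_forall_inv_mul_mem_discreteResidual [LocallyCompactSpace G]
    (hG : IsCompactlyGeneratedGroup G)
    (hfin : ∀ N : Subgroup G, N.Normal → DiscreteTopology (G ⧸ N) → Finite (G ⧸ N)) :
    ∃ K : Set G, IsCompact K ∧ ∀ g : G, ∃ k ∈ K, k⁻¹ * g ∈ discreteResidual G := by
  obtain ⟨L, hL, hL1, hinv, hgen⟩ := hG.exists_symmetric_nhds
  obtain ⟨W, hWn, hWo, hWL⟩ :=
    exists_openNormalSubgroup_subset_mul_discreteResidual hL hL1 hinv hgen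
  have : Finite (G ⧸ W) := hfin W hWn (QuotientGroup.discreteTopology hWo)
  refine ⟨Set.range (Quotient.out : G ⧸ W → G) * L, (Set.finite_range _).isCompact.mul hL,
    fun g => ?_⟩
  obtain ⟨l, hl, r, hr, e⟩ := hWL (QuotientGroup.eq.1 (QuotientGroup.out_eq' (g : G ⧸ W)))
  refine ⟨_, Set.mul_mem_mul ⟨(g : G ⧸ W), rfl⟩ hl, ?_⟩
  have e' : (Quotient.out (g : G ⧸ W) * l)⁻¹ * g = r := by
    rw [mul_inv_rev, mul_assoc, ← e]
    simp
  exact e' ▸ hr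

theorem compactSpace_quotient_of_forall_inv_mul_mem {G : Type*} [Group G] [TopologicalSpace G]
    {R : Subgroup G} {K : Set G} (hK : IsCompact K) (hKR : ∀ g : G, ∃ k ∈ K, k⁻¹ * g ∈ R) :
    CompactSpace (G ⧸ R) := by
  refine ⟨?_⟩
  convert hK.image (QuotientGroup.continuous_mk (N := R))
  refine (Set.eq_univ_of_forall fun q => ?_).symm
  obtain ⟨g, rfl⟩ := QuotientGroup.mk_surjective q
  obtain ⟨k, hk, h⟩ := hKR g
  exact ⟨k, hk, QuotientGroup.eq.2 h⟩

/-- A closed cocompact subgroup of a compactly generated group is generated by a compact set: with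
`G = K * R` and `S` a compact generating set, Schreier's argument shows that `R ∩ K⁻¹ * S * K`
generates `R`. -/
theorem exists_isCompact_closure_eq [LocallyCompactSpace G] (hG : IsCompactlyGeneratedGroup G)
    {R : Subgroup G} (hR : IsClosed (R : Set G)) {K : Set G} (hK : IsCompact K)
    (hKR : ∀ g : G, ∃ k ∈ K, k⁻¹ * g ∈ R) :
    ∃ E : Set G, IsCompact E ∧ Subgroup.closure E = R := by
  obtain ⟨S, hS, hS1, hinv, hgen⟩ := hG.exists_symmetric_nhds
  have h1S : (1 : G) ∈ S := mem_of_mem_nhds hS1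
  set K' := insert 1 K
  have hK' : IsCompact K' := hK.insert 1
  set E := K'⁻¹ * S * K' ∩ (R : Set G)
  have hER : Subgroup.closure E ≤ R := (Subgroup.closure_le R).2 fun x hx => hx.2
  refine ⟨E, ((hK'.inv.mul hS).mul hK').inter_right hR, le_antisymm hER fun r hr => ?_⟩
  have step : ∀ s ∈ S, ∀ g : G, (∃ k ∈ K', k⁻¹ * g ∈ Subgroup.closure E) →
      ∃ k ∈ K', k⁻¹ * (s * g) ∈ Subgroup.closure E := by
    rintro s hs g ⟨k, hk, h⟩
    obtain ⟨k', hk', h'⟩ := hKR (s * k)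
    refine ⟨k', Or.inr hk', ?_⟩
    have e : k'⁻¹ * (s * g) = k'⁻¹ * (s * k) * (k⁻¹ * g) := by group
    rw [e]
    refine mul_mem (Subgroup.subset_closure ⟨?_, h'⟩) h
    rw [← mul_assoc]
    exact Set.mul_mem_mul (Set.mul_mem_mul (Set.inv_mem_inv.2 (Or.inr hk')) hs) hk
  have all : ∀ g ∈ Subgroup.closure S, ∃ k ∈ K', k⁻¹ * g ∈ Subgroup.closure E := by
    intro g hg
    induction hg using Subgroup.closure_induction_left with
    | one => exact ⟨1, Or.inl rfl, by simp⟩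
    | mul_left s hs g _ ih => exact step s hs g ih
    | inv_mul_cancel s hs g _ ih => exact step _ (hinv s hs) g ih
  obtain ⟨k, hk, h⟩ := all r (hgen ▸ Subgroup.mem_top r)
  have hkR : k ∈ R := by
    have := R.mul_mem hr (R.inv_mem (hER h))
    simpa using this
  have hkE : k ∈ E :=
    ⟨⟨1, ⟨1, by simp [K'], 1, h1S, by simp⟩, k, hk, one_mul k⟩, hkR⟩
  simpa using mul_mem (Subgroup.subset_closure hkE) h

end Cocompact

/-! ### Discrete quotients of the discrete residual -/

section DiscreteQuotient

variable {G : Type*} [Group G] [TopologicalSpace G] [IsTopologicalGroup G]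

/-- If the discrete residual `R` is cocompact, every normal subgroup `V` of `G` contained in `R` and
open in `R` is the intersection with `R` of an open subgroup of `G`. -/
theorem exists_isOpen_inf_discreteResidual_le {K : Set G} (hK : IsCompact K)
    (hKR : ∀ g : G, ∃ k ∈ K, k⁻¹ * g ∈ discreteResidual G) {V : Subgroup G} [hV : V.Normal]
    (hVR : V ≤ discreteResidual G) (hRV : ∀ᶠ x in 𝓝 (1 : G), x ∈ discreteResidual G → x ∈ V) :
    ∃ W : Subgroup G, IsOpen (W : Set G) ∧ V ≤ W ∧ W ⊓ discreteResidual G ≤ V := by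
  set R := discreteResidual G with hRdef
  -- By continuity at `1`, products `a⁻¹ * b * c⁻¹` of elements near `1` lying in `R` lie in `V`.
  obtain ⟨O, hO, hO1, hOV⟩ : ∃ O : Set G, IsOpen O ∧ (1 : G) ∈ O ∧
      ∀ a ∈ O, ∀ b ∈ O, ∀ c ∈ O, (a⁻¹ * b * c⁻¹ ∈ R → a⁻¹ * b * c⁻¹ ∈ V) := by
    have hc : Continuous fun p : G × G × G => p.1⁻¹ * p.2.1 * p.2.2⁻¹ := by fun_prop
    have ht := hc.tendsto (1, 1, 1)
    simp only [inv_one, mul_one] at ht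
    have h := ht.eventually hRV
    rw [nhds_prod_eq, nhds_prod_eq] at h
    obtain ⟨A, hA, B, hB, hAB⟩ := eventually_prod_iff.1 h
    obtain ⟨B₁, hB₁, B₂, hB₂, hBB⟩ := eventually_prod_iff.1 hB
    obtain ⟨O, hOs, hO, hO1⟩ := mem_nhds_iff.1 (hA.and (hB₁.and hB₂))
    exact ⟨O, hO, hO1, fun a ha b hb c hc =>
      hAB (hOs ha).1 (hBB (hOs hb).2.1 (hOs hc).2.2)⟩
  obtain ⟨M, hM⟩ := exists_openNormalSubgroup_inter_subset hK (hO.mul_right (t := (R : Set G)))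
    (fun r hr => ⟨1, hO1, r, hr, one_mul r⟩)
  have hRM : R ≤ M.toSubgroup := discreteResidual_le M.isNormal' M.isOpen'
  have hMO : ∀ x ∈ M.toSubgroup, ∃ o ∈ O, o⁻¹ * x ∈ R := by
    intro x hx
    obtain ⟨k, hk, h⟩ := hKR x
    have hkM : k ∈ M.toSubgroup := by
      simpa using M.toSubgroup.mul_mem hx (M.toSubgroup.inv_mem (hRM h))
    obtain ⟨o, ho, r, hr, e⟩ := hM k hk hkM
    refine ⟨o, ho, ?_⟩
    have e' : o⁻¹ * x = r * (k⁻¹ * x) := by rw [← e]; simp [mul_assoc]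
    exact e' ▸ R.mul_mem hr h
  -- Closure under division suffices for `M ∩ O * V` to be a subgroup.
  have hdiv : ∀ x ∈ M.toSubgroup, ∀ y ∈ M.toSubgroup, x ∈ O * (V : Set G) →
      y ∈ O * (V : Set G) → x * y⁻¹ ∈ O * (V : Set G) := by
    rintro _ hx _ hy ⟨b, hb, v, hv, rfl⟩ ⟨c, hc, w, hw, rfl⟩
    obtain ⟨a, ha, hr⟩ := hMO _ (M.toSubgroup.mul_mem hx (M.toSubgroup.inv_mem hy))
    have hu : c * (v * w⁻¹) * c⁻¹ ∈ V := hV.conj_mem _ (V.mul_mem hv (V.inv_mem hw)) c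
    have e : a⁻¹ * (b * v * (c * w)⁻¹) = a⁻¹ * b * c⁻¹ * (c * (v * w⁻¹) * c⁻¹) := by group
    have hr' : a⁻¹ * (b * v * (c * w)⁻¹) ∈ V := by
      simp only [e] at hr ⊢
      exact V.mul_mem (hOV a ha b hb c hc ((R.mul_mem_cancel_right (hVR hu)).1 hr)) hu
    exact ⟨a, ha, _, hr', by simp⟩
  have h1 : (1 : G) ∈ O * (V : Set G) := ⟨1, hO1, 1, V.one_mem, one_mul 1⟩
  have hinv : ∀ x ∈ M.toSubgroup, x ∈ O * (V : Set G) → x⁻¹ ∈ O * (V : Set G) :=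
    fun x hx hx' => by simpa using hdiv 1 M.toSubgroup.one_mem x hx h1 hx'
  let W : Subgroup G :=
    { carrier := {x | x ∈ M.toSubgroup ∧ x ∈ O * (V : Set G)}
      one_mem' := ⟨M.toSubgroup.one_mem, h1⟩
      mul_mem' := fun {x y} hx hy => ⟨M.toSubgroup.mul_mem hx.1 hy.1, by
        simpa using hdiv x hx.1 y⁻¹ (M.toSubgroup.inv_mem hy.1) hx.2 (hinv y hy.1 hy.2)⟩
      inv_mem' := fun {x} hx => ⟨M.toSubgroup.inv_mem hx.1, hinv x hx.1 hx.2⟩ }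
  refine ⟨W, M.isOpen'.inter hO.mul_right,
    fun v hv => ⟨hRM (hVR hv), 1, hO1, v, hv, one_mul v⟩, ?_⟩
  rintro _ ⟨⟨-, b, hb, v, hv, rfl⟩, hbR⟩
  have hb' := hOV 1 hO1 b hb 1 hO1
  simp only [inv_one, one_mul, mul_one] at hb'
  exact V.mul_mem (hb' ((R.mul_mem_cancel_right (hVR hv)).1 hbR)) hv

/-- If the discrete residual is cocompact and generated by a compact set, it has no proper normal
open subgroup. Openness of `N` in the discrete residual is expressed by neighbourhoods of `1`. -/
theorem discreteResidual_le_of_eventually_mem {K E : Set G} (hK : IsCompact K)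
    (hKR : ∀ g : G, ∃ k ∈ K, k⁻¹ * g ∈ discreteResidual G) (hE : IsCompact E)
    (hER : Subgroup.closure E = discreteResidual G) {N : Subgroup G}
    (hNR : N ≤ discreteResidual G) (hN : ∀ r ∈ discreteResidual G, ∀ a ∈ N, r * a * r⁻¹ ∈ N)
    (hRN : ∀ᶠ x in 𝓝 (1 : G), x ∈ discreteResidual G → x ∈ N) :
    discreteResidual G ≤ N := by
  set R := discreteResidual G with hRdef
  have hRV := eventually_mem_normalCore hK hKR hN hRN
  set V := N.normalCore
  have hVN : V ≤ N := N.normalCore_le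
  obtain ⟨W, hWo, hVW, hWR⟩ := exists_isOpen_inf_discreteResidual_le hK hKR (hVN.trans hNR) hRV
  have hCo := isOpen_comap_centralizer hE hER hRV
  set C : Subgroup G := (Subgroup.centralizer (R.map (QuotientGroup.mk' V) : Set (G ⧸ V))).comap
    (QuotientGroup.mk' V)
  have hconj : ∀ r ∈ R, ∀ a ∈ W ⊓ C, r * a * r⁻¹ ∈ W ⊓ C := by
    rintro r hr a ⟨haW, haC⟩
    have h1 : QuotientGroup.mk' V a = QuotientGroup.mk' V (r * a * r⁻¹) := by
      rw [map_mul, map_mul, map_inv, eq_mul_inv_iff_mul_eq]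
      exact (Subgroup.mem_centralizer_iff.1 haC _ ⟨r, hr, rfl⟩).symm
    refine ⟨?_, ?_⟩
    · simpa using W.mul_mem haW (hVW (QuotientGroup.eq.1 h1))
    · exact Subgroup.mem_comap.2 (h1 ▸ Subgroup.mem_comap.1 haC)
  have hQ : ∀ᶠ x in 𝓝 (1 : G), x ∈ (⊤ : Subgroup G) → x ∈ (W ⊓ C).normalCore := by
    refine eventually_mem_normalCore hK hKR hconj ?_
    filter_upwards [hWo.mem_nhds W.one_mem, hCo.mem_nhds C.one_mem] with x hx hx' _
    exact ⟨hx, hx'⟩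
  have hQo : IsOpen ((W ⊓ C).normalCore : Set G) :=
    Subgroup.isOpen_of_mem_nhds _ (hQ.mono fun x hx => hx (Subgroup.mem_top x))
  have hRQ : R ≤ (W ⊓ C).normalCore := discreteResidual_le inferInstance hQo
  exact fun r hr => hVN (hWR ⟨((W ⊓ C).normalCore_le (hRQ hr)).1, hr⟩)

end DiscreteQuotient

/-! ### The structure theorem -/

theorem mainTheorem6 {G : Type*} [Group G] [TopologicalSpace G] [IsTopologicalGroup G]
    [T2Space G] [LocallyCompactSpace G] (hG : IsCompactlyGeneratedGroup G)
    (hfin : ∀ N : Subgroup G, N.Normal → DiscreteTopology (G ⧸ N) → Finite (G ⧸ N)) :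
    IsClosed (discreteResidual G : Set G) ∧
    CompactSpace (G ⧸ discreteResidual G) ∧
    IsTopologicallyCharacteristic (discreteResidual G) ∧
    ∀ N : Subgroup (discreteResidual G), N.Normal →
      DiscreteTopology (discreteResidual G ⧸ N) →
        Subsingleton (discreteResidual G ⧸ N) := by
  obtain ⟨K, hK, hKR⟩ := exists_isCompact_forall_inv_mul_mem_discreteResidual hG hfin
  obtain ⟨E, hE, hER⟩ := exists_isCompact_closure_eq hG isClosed_discreteResidual hK hKR
  refine ⟨isClosed_discreteResidual, compactSpace_quotient_of_forall_inv_mul_mem hK hKR,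
    isTopologicallyCharacteristic_discreteResidual, fun N hN hd => ?_⟩
  have hNo : IsOpen (N : Set (discreteResidual G)) := by
    have h := (isOpen_discrete ({1} : Set (discreteResidual G ⧸ N))).preimage
      (QuotientGroup.continuous_mk (N := N))
    convert h using 1
    ext x
    simp [QuotientGroup.eq_one_iff]
  obtain ⟨O, hO, hON⟩ := isOpen_induced_iff.1 hNo
  have hmem : ∀ x : discreteResidual G, (x : G) ∈ O ↔ x ∈ N := fun x => by
    rw [← SetLike.mem_coe, ← hON]; rfl
  have hle := discreteResidual_le_of_eventually_mem (N := N.map (discreteResidual G).subtype)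
    hK hKR hE hER (Subgroup.map_subtype_le N)
    (by
      rintro r hr _ ⟨a, ha, rfl⟩
      exact ⟨_, hN.conj_mem a ha ⟨r, hr⟩, rfl⟩)
    (by
      filter_upwards [hO.mem_nhds ((hmem 1).2 N.one_mem)] with x hx hxR
      exact ⟨⟨x, hxR⟩, (hmem ⟨x, hxR⟩).1 hx, rfl⟩)
  have htop : N = ⊤ := by
    refine top_le_iff.1 fun x _ => ?_
    obtain ⟨y, hy, e⟩ := hle x.2
    exact (Subtype.ext e : y = x) ▸ hy
  subst htop
  exact QuotientGroup.subsingleton_quotient_top
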